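/- Let $(\varphi_e)_{e\in\mathbb N}$ be a standard numbering of the partial computable functions $\mathbb N\rightharpoonup\mathbb N$, let $W_e=\operatorname{dom}\varphi_e$ be the $e$-th c.e. set, let $\langle\cdot,\cdot\rangle$ be a computable pairing bijection on $\mathbb N$, and let $$P_a=\{z\in\mathbb N : \forall x\,\exists y\ \text{($\varphi_a(\langle z,x\rangle)$ halts within bound $y$)}\}$$ be the $\Pi^0_2$ set with index $a$; every $a\in\mathbb N$ is an index, and every $\Pi^0_2$ subset of $\mathbb N$ is some $P_a$. A $2$-coloring of pairs is a function $c:[\mathbb N]^2\to\{0,1\}$, where $[\mathbb N]^2$ is the set of two-element subsets of $\mathbb N$. The number $e$ is a code of the total computable $2$-coloring $c$ if $\varphi_e$ is total and $\varphi_e(\langle a,b\rangle)=c(\{a,b\})$ for all $a\neq b$. A set $H\subseteq\mathbb N$ is an infinite homogeneous set for $c$ if $H$ is infinite and $c$ is constant on $[H]^2$. **Theorem.** There is no partial computable function $f:\mathbb N\rightharpoonup\mathbb N$ such that for every $e$ and every $2$-coloring $c:[\mathbb N]^2\to\{0,1\}$, if $e$ is a code of $c$, then $f(e)$ halts, the c.e.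 set $W_{f(e)}$ is finite, and for at least one $a\in W_{f(e)}$ the set $P_a$ is an infinite homogeneous set for $c$. In particular, there is no partial computable $f:\mathbb N\rightharpoonup\mathbb N$ such that for every $e$ and $c$ as above, if $e$ is a code of $c$, then $f(e)$ halts and is the canonical index $u=\sum_{a\in D}2^{a}$ of a finite set $D\subseteq\mathbb N$ such that for at least one $a\in D$ the set $P_a$ is an infinite homogeneous set for $c$. -/

import Mathlib

namespace RamseyPairs

/-- The partial computable function `φ_e`, in the standard numbering of programs. -/
def phi (e : ℕ) : ℕ →. ℕ :=
  (Denumerable.ofNat Nat.Partrec.Code e).eval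

/-- The `e`-th computably enumerable set `W_e`, the domain of `φ_e`. -/
def W (e : ℕ) : Set ℕ :=
  {z | (phi e z).Dom}

/-- The relation `T (a, z, x, y)`: program `a` halts on input `⟨z, x⟩` within the bound `y`.
It is decidable, uniformly in all four arguments. -/
def HaltsWithin (a z x y : ℕ) : Prop :=
  (Nat.Partrec.Code.evaln y (Denumerable.ofNat Nat.Partrec.Code a) (Nat.pair z x)).isSome = true

/-- The `Π⁰₂` set with index `a`. Every natural number is an index, and as `a` varies these are
exactly the `Π⁰₂` sets of natural numbers (see `exists_pi02_index_iff`). -/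
def pi02Set (a : ℕ) : Set ℕ :=
  {z | ∀ x, ∃ y, HaltsWithin a z x y}

/-- The set of two-element subsets of the natural numbers. -/
abbrev Pairs : Type :=
  {s : Finset ℕ // s.card = 2}

/-- The two-element set consisting of `a` and `b`. -/
def mkPair (a b : ℕ) (h : a ≠ b) : Pairs :=
  ⟨{a, b}, Finset.card_pair h⟩

/-- A 2-coloring of pairs. -/
abbrev Coloring : Type :=
  Pairs → Fin 2

/-- `e` is a code of the total computable 2-coloring `c`: the function `φ_e` is total and, given
two distinct numbers in either order, it returns the color of the pair that they form. -/
def IsCode (e : ℕ) (c : Coloring) : Prop :=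
  (∀ n, (phi e n).Dom) ∧
    ∀ (a b : ℕ) (h : a ≠ b), (c (mkPair a b h) : ℕ) ∈ phi e (Nat.pair a b)

/-- `H` is an infinite homogeneous set for `c`. -/
def IsInfiniteHomogeneous (c : Coloring) (H : Set ℕ) : Prop :=
  H.Infinite ∧ ∃ i : Fin 2, ∀ s : Pairs, (s.1 : Set ℕ) ⊆ H → c s = i

/-- The finite set with canonical index `u`: the sum of `2 ^ a` over its elements `a` is `u`. -/
def canonicalFinset (u : ℕ) : Finset ℕ :=
  Finset.equivBitIndices u

theorem mem_pi02Set_iff (a z : ℕ) : z ∈ pi02Set a ↔ ∀ x, Nat.pair z x ∈ W a := by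
  refine forall_congr' fun x => ?_
  show (∃ y, HaltsWithin a z x y) ↔ (phi a (Nat.pair z x)).Dom
  simp only [phi, HaltsWithin, Option.isSome_iff_exists, Part.dom_iff_mem,
    Nat.Partrec.Code.evaln_complete]
  exact exists_comm

/-- The sets with an index are exactly those of the form `{z | ∀ x, ∃ y, R (z, x, y)}` with a
computable relation `R`. -/
theorem exists_pi02_index_iff (S : Set ℕ) :
    (∃ a, pi02Set a = S) ↔
      ∃ R : ℕ × ℕ × ℕ → Prop, ComputablePred R ∧ S = {z | ∀ x, ∃ y, R (z, x, y)} := by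
  constructor
  · rintro ⟨a, rfl⟩
    refine ⟨fun p => HaltsWithin a p.1 p.2.1 p.2.2, ?_, rfl⟩
    refine ComputablePred.computable_iff.2 ⟨fun p =>
      (Nat.Partrec.Code.evaln p.2.2 (Denumerable.ofNat Nat.Partrec.Code a)
        (Nat.pair p.1 p.2.1)).isSome, ?_, rfl⟩
    refine Primrec.to_comp (Primrec.option_isSome.comp
      (Nat.Partrec.Code.primrec_evaln.comp (Primrec.pair (Primrec.pair
        (Primrec.snd.comp Primrec.snd) (Primrec.const _)) ?_)))
    exact Primrec₂.natPair.comp Primrec.fst (Primrec.fst.comp Primrec.snd)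
  · rintro ⟨R, hR, rfl⟩
    obtain ⟨g, hg, rfl⟩ := ComputablePred.computable_iff.1 hR
    have hp : Partrec fun n : ℕ =>
        Nat.rfind fun y => Part.some (g ((Nat.unpair n).1, (Nat.unpair n).2, y)) := by
      refine Partrec.rfind (Computable.partrec (hg.comp ?_))
      exact (Computable.fst.comp (Computable.unpair.comp Computable.fst)).pair
        ((Computable.snd.comp (Computable.unpair.comp Computable.fst)).pair Computable.snd)
    obtain ⟨code, hcode⟩ := Nat.Partrec.Code.exists_code.1 (Partrec.nat_iff.1 hp)
    refine ⟨Encodable.encode code, Set.ext fun z => ?_⟩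
    rw [mem_pi02Set_iff]
    refine forall_congr' fun x => ?_
    show (phi _ (Nat.pair z x)).Dom ↔ ∃ y, g (z, x, y) = true
    simp only [phi, Denumerable.ofNat_encode, hcode, Nat.unpair_pair]
    exact Nat.rfind_dom'.trans ⟨fun ⟨y, hy, _⟩ => ⟨y, (Part.mem_some_iff.1 hy).symm⟩,
      fun ⟨y, hy⟩ => ⟨y, Part.mem_some_iff.2 hy.symm, fun _ => trivial⟩⟩

end RamseyPairs

open RamseyPairs

/-!
The recursion theorem turns the problem into a diagonalization: a program `e` may compute a coloring
`c` that depends on the output of `f e`. From that output the program approximates, at each stage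
`s`, a number `n` that bounds the indices provided by `f e`, and whose value is eventually constant
(`exists_eventually_enumBound_eq`, `lt_of_mem_canonicalFinset`). It remains to color pairs so that
no infinite `pi02Set a` with `a < n` is homogeneous, where `n` is the eventual bound.

The row of `c` at `s`, that is, the coloring `y ↦ c {y, s}` of the numbers below `s`, is chosen by
looking at stage `s` approximations only. If a finite set `F ⊆ pi02Set a` is split by all rows
`s` with `s` large, then `pi02Set a` is not homogeneous, as can be seen from the row of any large
`s ∈ pi02Set a`. Such a set `F` is found by the process `region`: an initial segment of `ℕ` is
inspected for as long as at least `M = 4 * n + 1` of its elements look like elements of `pi02Set a`,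
and otherwise it is replaced by a longer one. For an infinite `pi02Set a` this process settles at
some time `T` on at least `M` true elements (`exists_candidates_subset`), and the approximation at
every large stage `s` agrees with it up to time `T` (`eventually_candidates_approx`).

Since stage `s` does not reveal which time is the right one, the row at `s` has to split the
candidates of all `n` indices at all times up to `s`. That this is possible, although the number of
these requirements is unbounded in terms of `M`, is the combinatorial core of the proof
(`exists_coloring_extending`, `exists_coloring_of_card_lt`). As long as a region is kept its
candidates decrease, so two points of different colors among the latest candidates serve for all
earlier times too. When the region is replaced at time `t`, its successor is `{y | y < t}`, so all
earlier candidates lie below it. Running backwards in time, each index therefore needs at most four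
colored points at any moment, and `4 * n < M` leaves a free one.
-/

namespace RamseyPairs

/-! ### Splitting all candidate sets by one coloring -/

open Classical in
/-- For a decreasing sequence `Q 0, Q 1, …` of sets and a threshold `M`, the initial segment
`{y | y < region Q M t}` of `ℕ` that is under inspection at time `t`. It is kept as long as at least
`M` of its elements survive in `Q`; when fewer survive at time `t + 1`, it is replaced by
`{y | y < t + 1}`. -/
noncomputable def region (Q : ℕ → ℕ → Prop) (M : ℕ) : ℕ → ℕ
  | 0 => 0
  | t + 1 =>
    if ((Finset.range (region Q M t)).filter (Q (t + 1))).card < M then t + 1 else region Q M t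

open Classical in
/-- The elements of the current region that belong to `Q t`. -/
noncomputable def candidates (Q : ℕ → ℕ → Prop) (M t : ℕ) : Finset ℕ :=
  (Finset.range (region Q M t)).filter (Q t)

theorem mem_candidates {Q : ℕ → ℕ → Prop} {M t y : ℕ} :
    y ∈ candidates Q M t ↔ y < region Q M t ∧ Q t y := by
  simp [candidates]

theorem region_le (Q : ℕ → ℕ → Prop) (M t : ℕ) : region Q M t ≤ t := by
  induction t with
  | zero => simp [region]
  | succ t ih => rw [region]; split_ifs <;> omega

theorem region_succ_eq_or (Q : ℕ → ℕ → Prop) (M t : ℕ) :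
    region Q M (t + 1) = t + 1 ∨ region Q M (t + 1) = region Q M t := by
  rw [region]; split_ifs <;> simp

theorem region_mono (Q : ℕ → ℕ → Prop) (M : ℕ) : Monotone (region Q M) := by
  refine monotone_nat_of_le_succ fun t => ?_
  have := region_le Q M t
  rcases region_succ_eq_or Q M t with h | h <;> omega

theorem candidates_subset_range (Q : ℕ → ℕ → Prop) (M t : ℕ) :
    candidates Q M t ⊆ Finset.range t := fun _ hy =>
  Finset.mem_range.2 ((mem_candidates.1 hy).1.trans_le (region_le Q M t))

theorem card_le_two_of_injOn {ρ : ℕ → Bool} {A : Finset ℕ} (h : Set.InjOn ρ A) : A.card ≤ 2 :=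
  (Finset.card_le_card_of_injOn ρ (fun _ _ => Finset.mem_univ _) h).trans_eq (by simp)

/-- The induction behind `exists_coloring_of_card_lt`. The colors are constructed backwards in time.
The set `A i` holds at most two points of `candidates (Q i) M T` whose colors `ρ` are already fixed,
and `B i` holds at most two further colored points, which lie outside the region at time `T` and
come from the region that replaces it later; in total at most `4 * card ι < M` points are colored.
Whenever there are `M` candidates for `i`, one of them is uncolored, so `A i` can be filled up to
two points of different colors. Going back one step in time, either the region of `i` is the same, and
then `A i` is kept and `B i` can only shrink; or it was just replaced, and then `B i` is empty and
the points of `A i` below the new time are distributed over the new `A i` and the new `B i`. -/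
theorem exists_coloring_extending {ι : Type*} [Fintype ι] {Q : ι → ℕ → ℕ → Prop}
    (hQ : ∀ i y, Antitone fun t => Q i t y) {M : ℕ} (hM : 4 * Fintype.card ι < M) (T : ℕ) :
    ∀ (A B : ι → Finset ℕ) (ρ : ℕ → Bool), (∀ i, A i ⊆ candidates (Q i) M T) →
      (∀ i, Set.InjOn ρ (A i)) → (∀ i, B i ⊆ Finset.Ico (region (Q i) M T) T) →
      (∀ i, (B i).card ≤ 2) →
      ∃ v : ℕ → Bool, (∀ i, ∀ y ∈ A i ∪ B i, v y = ρ y) ∧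
        ∀ t ≤ T, ∀ i, M ≤ (candidates (Q i) M t).card →
          ∃ y ∈ candidates (Q i) M t, ∃ z ∈ candidates (Q i) M t, v y ≠ v z := by
  classical
  induction T with
  | zero =>
    intro A B ρ _ _ _ _
    refine ⟨ρ, fun _ _ _ => rfl, fun t ht i hi => ?_⟩
    obtain rfl : t = 0 := by omega
    simp [candidates, region] at hi
    omega
  | succ T ih =>
    intro A B ρ hA hρ hB hB2
    induction hk : 2 * Fintype.card ι - ∑ i, (A i).card using Nat.strong_induction_on
      generalizing A ρ with
    | _ k ihk =>
    -- Once every `i` with `M` candidates has two colored ones, time `T + 1` is settled.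
    by_cases hsat : ∀ i, M ≤ (candidates (Q i) M (T + 1)).card → 1 < (A i).card
    · have hprev := ih (fun i => (A i).filter (· < region (Q i) M T))
        (fun i => (A i ∪ B i).filter fun y => region (Q i) M T ≤ y ∧ y < T) ρ ?_ ?_ ?_ ?_
      · obtain ⟨v, hvρ, hv⟩ := hprev
        have hvA : ∀ i, ∀ y ∈ A i ∪ B i, y < T → v y = ρ y := by
          intro i y hy hyT
          refine hvρ i y ?_
          simp only [Finset.mem_union, Finset.mem_filter] at hy ⊢
          rcases lt_or_ge y (region (Q i) M T) with h | h
          · rcases hy with hy | hy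
            · exact Or.inl ⟨hy, h⟩
            · have := (Finset.mem_Ico.1 (hB i hy)).1
              have := region_mono (Q i) M (T.le_add_right 1)
              omega
          · exact Or.inr ⟨hy, h, hyT⟩
        have hwρ : ∀ i, ∀ y ∈ A i ∪ B i, (if y < T then v y else ρ y) = ρ y := by
          intro i y hy
          split_ifs with h
          · exact hvA i y hy h
          · rfl
        -- The clauses for times up to `T` only involve points below `T`, so the colors of the
        -- other points may be reset to `ρ`.
        refine ⟨fun y => if y < T then v y else ρ y, hwρ, fun t ht i hi => ?_⟩
        rcases Nat.le_succ_iff.1 ht with ht | rfl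
        · obtain ⟨y, hy, z, hz, hyz⟩ := hv t ht i hi
          have hlt : ∀ x ∈ candidates (Q i) M t, x < T := fun x hx =>
            (Finset.mem_range.1 (candidates_subset_range _ _ _ hx)).trans_le ht
          exact ⟨y, hy, z, hz, by simpa only [hlt y hy, hlt z hz, if_true] using hyz⟩
        · obtain ⟨y, hy, z, hz, hyz⟩ := Finset.one_lt_card.1 (hsat i hi)
          refine ⟨y, hA i hy, z, hA i hz, ?_⟩
          simp only [hwρ i y (Finset.mem_union_left _ hy), hwρ i z (Finset.mem_union_left _ hz)]
          exact fun h => hyz (hρ i hy hz h)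
      · intro i y hy
        obtain ⟨hy, hlt⟩ := Finset.mem_filter.1 hy
        exact mem_candidates.2 ⟨hlt, hQ i y (Nat.le_succ T) (mem_candidates.1 (hA i hy)).2⟩
      · exact fun i => (hρ i).mono (Finset.coe_subset.2 (Finset.filter_subset _ _))
      · intro i y hy
        exact Finset.mem_Ico.2 (Finset.mem_filter.1 hy).2
      · intro i
        rcases region_succ_eq_or (Q i) M T with h | h
        · refine (Finset.card_le_card ?_).trans (card_le_two_of_injOn (hρ i))
          intro y hy
          obtain ⟨hy, -⟩ := Finset.mem_filter.1 hy
          refine (Finset.mem_union.1 hy).resolve_right fun hyB => ?_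
          have := Finset.mem_Ico.1 (hB i hyB)
          omega
        · refine (Finset.card_le_card ?_).trans (hB2 i)
          intro y hy
          obtain ⟨hy, hr, -⟩ := Finset.mem_filter.1 hy
          refine (Finset.mem_union.1 hy).resolve_left fun hyA => ?_
          have := (mem_candidates.1 (hA i hyA)).1
          omega
    · push Not at hsat
      obtain ⟨i, hi, hAi⟩ := hsat
      have hA2 : ∀ j, (A j).card ≤ 2 := fun j => card_le_two_of_injOn (hρ j)
      have hD : (Finset.univ.biUnion fun j => A j ∪ B j).card < M := by
        refine lt_of_le_of_lt (Finset.card_biUnion_le_card_mul _ _ 4 fun j _ => ?_)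
          (by rw [Finset.card_univ]; omega)
        have := Finset.card_union_le (A j) (B j)
        have := hA2 j
        have := hB2 j
        omega
      -- Fewer than `M` points are colored, so some candidate `y` for `i` is not; it receives the
      -- color that does not occur on `A i`.
      obtain ⟨y, hy, hyD⟩ := Finset.exists_mem_notMem_of_card_lt_card (hD.trans_le hi)
      have hyn : ∀ j, ∀ z ∈ A j ∪ B j, z ≠ y := by
        rintro j z hz rfl
        exact hyD (Finset.mem_biUnion.2 ⟨j, Finset.mem_univ _, hz⟩)
      have hyA : y ∉ A i := fun h => hyn i y (Finset.mem_union_left _ h) rfl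
      obtain ⟨b, hb⟩ : ∃ b : Bool, ∀ z ∈ A i, ρ z ≠ b := by
        rcases Finset.card_le_one_iff_subset_singleton.1 hAi with ⟨x, hx⟩
        refine ⟨!ρ x, fun z hz => ?_⟩
        rw [Finset.mem_singleton.1 (hx hz)]
        simp
      have hρ' : ∀ j, ∀ z ∈ A j ∪ B j, Function.update ρ y b z = ρ z := fun j z hz =>
        Function.update_of_ne (hyn j z hz) _ _
      have hsub : ∀ j, A j ⊆ Function.update A i (insert y (A i)) j := by
        intro j
        rcases eq_or_ne j i with rfl | h
        · simp
        · simp [h]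
      have hsum : ∑ j, (Function.update A i (insert y (A i)) j).card = ∑ j, (A j).card + 1 := by
        rw [← Finset.add_sum_erase _ _ (Finset.mem_univ i),
          ← Finset.add_sum_erase _ (fun j => (A j).card) (Finset.mem_univ i)]
        rw [Finset.sum_congr rfl fun j hj => by
          rw [Function.update_of_ne (Finset.ne_of_mem_erase hj)]]
        simp [hyA]
        ring
      have hlt : ∑ j, (A j).card < 2 * Fintype.card ι := by
        have : ∑ j, (A j).card < ∑ _j : ι, 2 :=
          Finset.sum_lt_sum (fun j _ => hA2 j) ⟨i, Finset.mem_univ _, by omega⟩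
        simpa [mul_comm] using this
      have hext := ihk _ (by omega) (Function.update A i (insert y (A i)))
        (Function.update ρ y b) ?_ ?_ rfl
      · obtain ⟨v, hvρ, hv⟩ := hext
        refine ⟨v, fun j z hz => ?_, hv⟩
        rw [hvρ j z (Finset.union_subset_union_left (hsub j) hz), hρ' j z hz]
      · intro j
        rcases eq_or_ne j i with rfl | h
        · simpa using Finset.insert_subset hy (hA j)
        · simpa [h] using hA j
      · intro j
        have hj : Set.InjOn (Function.update ρ y b) (A j) := (hρ j).congr fun z hz =>
          (hρ' j z (Finset.mem_union_left _ hz)).symm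
        rcases eq_or_ne j i with rfl | h
        · rw [Function.update_self, Finset.coe_insert,
            Set.injOn_insert (by simpa using hyA)]
          refine ⟨hj, ?_⟩
          rintro ⟨z, hz, h⟩
          rw [hρ' j z (Finset.mem_union_left _ hz), Function.update_self] at h
          exact hb z hz h
        · rwa [Function.update_of_ne h]

/-- One coloring is non-constant on every candidate set with at least `M` elements, at all times up
to `T` and for all `n` sequences at once. The bound on `M` does not depend on `T`. -/
theorem exists_coloring_of_card_lt {n : ℕ} {Q : ℕ → ℕ → ℕ → Prop}
    (hQ : ∀ i y, Antitone fun t => Q i t y) {M : ℕ} (hM : 4 * n < M) (T : ℕ) :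
    ∃ v : ℕ → Bool, ∀ t ≤ T, ∀ i < n, M ≤ (candidates (Q i) M t).card →
      ∃ y ∈ candidates (Q i) M t, ∃ z ∈ candidates (Q i) M t, v y ≠ v z := by
  obtain ⟨v, -, hv⟩ := exists_coloring_extending (ι := Fin n) (Q := fun i => Q i)
    (fun i => hQ i) (M := M) (by simpa using hM) T (fun _ => ∅) (fun _ => ∅) (fun _ => false)
    (by simp) (by simp) (by simp) (by simp)
  exact ⟨v, fun t ht i hi => hv t ht ⟨i, hi⟩⟩

/-! ### Candidates for an infinite `Π⁰₂` set -/

/-- The candidates at time `T` depend on `Q t y` for `t ≤ T` and `y < T` only. -/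
theorem candidates_congr {Q Q' : ℕ → ℕ → Prop} {T : ℕ}
    (h : ∀ t ≤ T, ∀ y < T, Q t y ↔ Q' t y) (M : ℕ) :
    candidates Q M T = candidates Q' M T := by
  classical
  have hr : ∀ t ≤ T, region Q M t = region Q' M t := by
    intro t
    induction t with
    | zero => intro _; rfl
    | succ t ih =>
      intro ht
      have hf : (Finset.range (region Q M t)).filter (Q (t + 1)) =
          (Finset.range (region Q' M t)).filter (Q' (t + 1)) := by
        rw [← ih (by omega)]
        refine Finset.filter_congr fun y hy => h _ ht y ?_
        have := region_le Q M t
        have := Finset.mem_range.1 hy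
        omega
      rw [region, region, ← ih (by omega)]
      rw [← ih (by omega)] at hf
      congr! 3
  ext y
  rw [mem_candidates, mem_candidates, ← hr T le_rfl]
  exact and_congr_right fun hy => h T le_rfl y (hy.trans_le (region_le Q M T))

/-- If the intersection of the sequence is infinite, then at some time there are at least `M`
candidates, and all of them belong to the intersection. -/
theorem exists_candidates_subset {Q : ℕ → ℕ → Prop} (hQ : ∀ y, Antitone fun t => Q t y) (M : ℕ)
    (hP : {y | ∀ t, Q t y}.Infinite) :
    ∃ T, M ≤ (candidates Q M T).card ∧ ∀ y ∈ candidates Q M T, ∀ t, Q t y := by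
  classical
  -- A region with `M` elements of the intersection is never replaced, so the regions are bounded.
  obtain ⟨n, hn⟩ : ∃ n, ∀ t, region Q M t ≤ n := by
    by_contra! hunb
    obtain ⟨F, hFP, hF⟩ := hP.exists_subset_card_eq M
    obtain ⟨T, hT⟩ := hunb (F.sup id)
    have hconst : ∀ t ≥ T, region Q M t = region Q M T := by
      intro t ht
      induction t, ht using Nat.le_induction with
      | base => rfl
      | succ t ht ih =>
        rw [region, if_neg, ih]
        refine not_lt.2 (hF.ge.trans (Finset.card_le_card fun y hy =>
          Finset.mem_filter.2 ⟨?_, hFP hy _⟩))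
        rw [ih]
        exact Finset.mem_range.2 ((Finset.le_sup (f := id) hy).trans_lt hT)
    obtain ⟨t, ht⟩ := hunb (region Q M T)
    have := region_mono Q M (le_max_left t T)
    have := hconst (max t T) (le_max_right t T)
    omega
  obtain ⟨b, N, hN⟩ := converges_of_monotone_of_bounded (region_mono Q M) hn
  -- Below the final region `b`, the sequence reaches the intersection after finitely many steps.
  have hlim : ∀ᶠ t in Filter.atTop, ∀ y ∈ Finset.range b, Q t y → ∀ t', Q t' y := by
    refine (Filter.eventually_all_finset _).2 fun y _ => ?_
    by_cases hy : ∀ t', Q t' y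
    · exact .of_forall fun _ _ => hy
    · push Not at hy
      obtain ⟨t', ht'⟩ := hy
      filter_upwards [Filter.eventually_ge_atTop t'] with t ht h
      exact absurd (hQ y ht h) ht'
  obtain ⟨t, ht, htN⟩ :=
    (((Filter.tendsto_add_atTop_nat 1).eventually hlim).and
      (Filter.eventually_ge_atTop (N + b))).exists
  have hb : region Q M t = b := hN t (by omega)
  have hb' : region Q M (t + 1) = b := hN (t + 1) (by omega)
  refine ⟨t + 1, ?_, fun y hy => ?_⟩
  · have h := hb'
    rw [region] at h
    split_ifs at h with hc
    -- A replacement at time `t + 1 > b` would make the region larger than `b`.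
    · omega
    · rw [candidates, hb', ← hb]
      omega
  · obtain ⟨hyr, hy⟩ := mem_candidates.1 hy
    exact ht y (Finset.mem_range.2 (hb' ▸ hyr)) hy

/-- The approximation at stage `s` to the statement `y ∈ pi02Set a`, examined for the first `t`
values of the universally quantified variable: decreasing in `t` and increasing in `s`. -/
def approx (a s t y : ℕ) : Prop :=
  ∀ x < t, HaltsWithin a y x s

theorem approx_antitone (a s y : ℕ) : Antitone fun t => approx a s t y :=
  fun _ _ h H x hx => H x (hx.trans_le h)

theorem haltsWithin_mono {a z x s s' : ℕ} (hs : s ≤ s') (h : HaltsWithin a z x s) :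
    HaltsWithin a z x s' := by
  obtain ⟨v, hv⟩ := Option.isSome_iff_exists.1 h
  exact Option.isSome_iff_exists.2 ⟨v, Nat.Partrec.Code.evaln_mono hs hv⟩

theorem approx_mono {a s s' t y : ℕ} (hs : s ≤ s') (h : approx a s t y) : approx a s' t y :=
  fun x hx => haltsWithin_mono hs (h x hx)

theorem mem_pi02Set_iff_forall_exists_approx {a y : ℕ} :
    y ∈ pi02Set a ↔ ∀ t, ∃ s, approx a s t y := by
  constructor
  · intro h t
    choose s hs using h
    exact ⟨(Finset.range t).sup s, fun x hx =>
      haltsWithin_mono (Finset.le_sup (Finset.mem_range.2 hx)) (hs x)⟩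
  · intro h x
    obtain ⟨s, hs⟩ := h (x + 1)
    exact ⟨s, hs x x.lt_succ_self⟩

/-- If `pi02Set a` is infinite, then there is a fixed time `T` such that, for all large stages `s`,
there are at least `M` candidates at time `T`, all of them in `pi02Set a`. -/
theorem eventually_candidates_approx {a : ℕ} (h : (pi02Set a).Infinite) (M : ℕ) :
    ∃ T, ∀ᶠ s in Filter.atTop, M ≤ (candidates (approx a s) M T).card ∧
      ↑(candidates (approx a s) M T) ⊆ pi02Set a := by
  have hset : pi02Set a = {y | ∀ t, ∃ s, approx a s t y} :=
    Set.ext fun y => mem_pi02Set_iff_forall_exists_approx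
  -- The limit of the approximations as `s` grows.
  obtain ⟨T, hM, hT⟩ := exists_candidates_subset (Q := fun t y => ∃ s, approx a s t y)
    (fun y _ _ htt' ⟨s, hs⟩ => ⟨s, approx_antitone a s y htt' hs⟩) M (hset ▸ h)
  have hagree : ∀ᶠ s in Filter.atTop, ∀ t ∈ Finset.range (T + 1), ∀ y ∈ Finset.range T,
      (∃ s', approx a s' t y) → approx a s t y := by
    refine (Filter.eventually_all_finset _).2 fun t _ =>
      (Filter.eventually_all_finset _).2 fun y _ => ?_
    by_cases hs : ∃ s', approx a s' t y
    · obtain ⟨s', hs'⟩ := hs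
      filter_upwards [Filter.eventually_ge_atTop s'] with s hs _
      exact approx_mono hs hs'
    · exact .of_forall fun _ h => absurd h hs
  refine ⟨T, hagree.mono fun s hs => ?_⟩
  rw [candidates_congr (Q' := fun t y => ∃ s, approx a s t y) fun t ht y hy =>
    ⟨fun h => ⟨s, h⟩, hs t (Finset.mem_range.2 (by omega)) y (Finset.mem_range.2 hy)⟩]
  exact ⟨hM, fun y hy => mem_pi02Set_iff_forall_exists_approx.2 (hT y hy)⟩

/-! ### Primitive recursiveness of the requirements on a row -/

theorem primrecPred_forall_lt {α : Type*} [Primcodable α] {f : α → ℕ}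
    {R : ℕ → α → Prop} (hf : Primrec f) (hR : PrimrecRel R) :
    PrimrecPred fun a => ∀ x < f a, R x a :=
  (hR.forall_mem_list.comp (Primrec.list_range.comp hf) Primrec.id).of_eq (by simp)

theorem primrecPred_approx {α : Type*} [Primcodable α] {a s t y : α → ℕ} (ha : Primrec a)
    (hs : Primrec s) (ht : Primrec t) (hy : Primrec y) :
    PrimrecPred fun p => approx (a p) (s p) (t p) (y p) := by
  refine primrecPred_forall_lt ht (R := fun x p => HaltsWithin (a p) (y p) x (s p)) ?_
  refine Primrec.eq.comp (Primrec.option_isSome.comp (Nat.Partrec.Code.primrec_evaln.comp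
    (Primrec.pair (Primrec.pair (hs.comp Primrec.snd) ?_) ?_))) (Primrec.const true)
  · exact (Primrec.ofNat Nat.Partrec.Code).comp (ha.comp Primrec.snd)
  · exact Primrec₂.natPair.comp (hy.comp Primrec.snd) Primrec.fst

open Classical in
theorem primrec_list_filter_approx {α : Type*} [Primcodable α] {a s t r : α → ℕ}
    (ha : Primrec a) (hs : Primrec s) (ht : Primrec t) (hr : Primrec r) :
    Primrec fun p => (List.range (r p)).filter fun y => approx (a p) (s p) (t p) y := by
  have h : PrimrecRel fun (y : ℕ) (p : α) => approx (a p) (s p) (t p) y :=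
    primrecPred_approx (ha.comp Primrec.snd) (hs.comp Primrec.snd) (ht.comp Primrec.snd)
      Primrec.fst
  exact h.listFilter.comp (Primrec.list_range.comp hr) Primrec.id

open Classical in
theorem card_filter_range_eq_length (p : ℕ → Prop) (n : ℕ) :
    ((Finset.range n).filter p).card = ((List.range n).filter fun y => p y).length := rfl

theorem primrec_region {α : Type*} [Primcodable α] {a s M t : α → ℕ} (ha : Primrec a)
    (hs : Primrec s) (hM : Primrec M) (ht : Primrec t) :
    Primrec fun p => region (approx (a p) (s p)) (M p) (t p) := by
  classical
  have ha' : Primrec fun q : α × ℕ × ℕ => a q.1 := ha.comp Primrec.fst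
  have hs' : Primrec fun q : α × ℕ × ℕ => s q.1 := hs.comp Primrec.fst
  have hM' : Primrec fun q : α × ℕ × ℕ => M q.1 := hM.comp Primrec.fst
  have ht' : Primrec fun q : α × ℕ × ℕ => q.2.1 + 1 :=
    Primrec.succ.comp (Primrec.fst.comp Primrec.snd)
  have hr' : Primrec fun q : α × ℕ × ℕ => q.2.2 := Primrec.snd.comp Primrec.snd
  have hstep : Primrec₂ fun (p : α) (q : ℕ × ℕ) =>
      if ((List.range q.2).filter fun y => approx (a p) (s p) (q.1 + 1) y).length < M p
      then q.1 + 1 else q.2 :=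
    Primrec.ite (Primrec.nat_lt.comp
      (Primrec.list_length.comp (primrec_list_filter_approx ha' hs' ht' hr')) hM') ht' hr'
  refine (Primrec.nat_rec' ht (Primrec.const 0) hstep).of_eq fun p => ?_
  induction t p with
  | zero => rfl
  | succ n ih =>
    rw [region, card_filter_range_eq_length, ← ih]

open Classical in
/-- The elements of `candidates Q M t` in increasing order. -/
noncomputable def candidateList (Q : ℕ → ℕ → Prop) (M t : ℕ) : List ℕ :=
  (List.range (region Q M t)).filter fun y => Q t y

theorem mem_candidateList {Q : ℕ → ℕ → Prop} {M t y : ℕ} :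
    y ∈ candidateList Q M t ↔ y ∈ candidates Q M t := by
  simp [candidateList, candidates]

theorem length_candidateList (Q : ℕ → ℕ → Prop) (M t : ℕ) :
    (candidateList Q M t).length = (candidates Q M t).card := rfl

theorem primrec_candidateList {α : Type*} [Primcodable α] {a s M t : α → ℕ} (ha : Primrec a)
    (hs : Primrec s) (hM : Primrec M) (ht : Primrec t) :
    Primrec fun p => candidateList (approx (a p) (s p)) (M p) (t p) :=
  primrec_list_filter_approx ha hs ht (primrec_region ha hs hM ht)

/-- The color of `y` in the coloring of `ℕ` given by `l`: it is `0` or `1`, and `0` off the list. -/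
def listColor (l : List ℕ) (y : ℕ) : ℕ :=
  if l.getD y 0 = 0 then 0 else 1

theorem primrec_listColor : Primrec₂ listColor :=
  Primrec.ite (Primrec.eq.comp (Primrec.list_getD 0) (Primrec.const 0)) (Primrec.const 0)
    (Primrec.const 1)

/-- The coloring `l` takes both colors on the candidates for index `a` at stage `s` and time `t`,
provided that there are at least `4 * n + 1` of them. -/
def SplitsAt (n s : ℕ) (l : List ℕ) (t a : ℕ) : Prop :=
  4 * n + 1 ≤ (candidates (approx a s) (4 * n + 1) t).card →
    (∃ y ∈ candidates (approx a s) (4 * n + 1) t, listColor l y = 0) ∧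
      ∃ y ∈ candidates (approx a s) (4 * n + 1) t, listColor l y = 1

/-- The coloring `l` defeats the indices below `n` at stage `s`: it satisfies `SplitsAt` for all of
them, at all times up to `s`. -/
def IsGoodRow (n s : ℕ) (l : List ℕ) : Prop :=
  ∀ t < s + 1, ∀ a < n, SplitsAt n s l t a

theorem exists_isGoodRow (n s : ℕ) : ∃ l, IsGoodRow n s l := by
  obtain ⟨v, hv⟩ := exists_coloring_of_card_lt (Q := fun a => approx a s)
    (fun a y => approx_antitone a s y) (Nat.lt_succ_self (4 * n)) s
  refine ⟨(List.range s).map fun y => (v y).toNat, fun t ht a ha hcard => ?_⟩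
  have hcol : ∀ y ∈ candidates (approx a s) (4 * n + 1) t,
      listColor ((List.range s).map fun y => (v y).toNat) y = (v y).toNat := by
    intro y hy
    have hys : y < s := by
      have := Finset.mem_range.1 (candidates_subset_range _ _ _ hy)
      omega
    rw [listColor, List.getD_eq_getElem _ _ (by simpa using hys)]
    cases h : v y <;> simp [h]
  obtain ⟨y, hy, z, hz, hyz⟩ := hv t (by omega) a ha hcard
  have hy' := hcol y hy
  have hz' := hcol z hz
  cases h : v y <;> cases h' : v z <;> simp only [h, h', ne_eq, not_true_eq_false] at hyz
  · exact ⟨⟨y, hy, by simpa [h] using hy'⟩, z, hz, by simpa [h'] using hz'⟩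
  · exact ⟨⟨z, hz, by simpa [h'] using hz'⟩, y, hy, by simpa [h] using hy'⟩

theorem primrecPred_isGoodRow {α : Type*} [Primcodable α] {n s : α → ℕ} {l : α → List ℕ}
    (hn : Primrec n) (hs : Primrec s) (hl : Primrec l) :
    PrimrecPred fun p => IsGoodRow (n p) (s p) (l p) := by
  classical
  have hM : Primrec fun p : α => 4 * n p + 1 :=
    Primrec.succ.comp (Primrec.nat_mul.comp (Primrec.const 4) hn)
  have hcand : Primrec fun q : ℕ × ℕ × α =>
      candidateList (approx q.1 (s q.2.2)) (4 * n q.2.2 + 1) q.2.1 := by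
    have h2 : Primrec fun q : ℕ × ℕ × α => q.2.2 := Primrec.snd.comp Primrec.snd
    exact primrec_candidateList Primrec.fst (hs.comp h2) (hM.comp h2)
      (Primrec.fst.comp Primrec.snd)
  have hex : ∀ i : ℕ, PrimrecPred fun q : ℕ × ℕ × α =>
      ∃ y ∈ candidateList (approx q.1 (s q.2.2)) (4 * n q.2.2 + 1) q.2.1,
        listColor (l q.2.2) y = i := by
    intro i
    have h : PrimrecRel fun (y : ℕ) (p : α) => listColor (l p) y = i :=
      Primrec.eq.comp (primrec_listColor.comp (hl.comp Primrec.snd) Primrec.fst)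
        (Primrec.const i)
    exact h.exists_mem_list.comp hcand (Primrec.snd.comp Primrec.snd)
  have hsplit : PrimrecRel fun (a : ℕ) (q : ℕ × α) =>
      SplitsAt (n q.2) (s q.2) (l q.2) q.1 a :=
    ((Primrec.nat_lt.comp (Primrec.list_length.comp hcand)
      (hM.comp (Primrec.snd.comp Primrec.snd))).or ((hex 0).and (hex 1))).of_eq fun q => by
        simp only [SplitsAt, mem_candidateList, length_candidateList, ← not_le, ← imp_iff_not_or]
  have hall : PrimrecRel fun (t : ℕ) (p : α) =>
      ∀ a < n p, SplitsAt (n p) (s p) (l p) t a :=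
    primrecPred_forall_lt (hn.comp Primrec.snd) hsplit
  exact primrecPred_forall_lt (Primrec.succ.comp hs) hall

/-! ### The diagonal coloring -/

open Classical in
/-- The least code of a good row. -/
noncomputable def goodRowCode (n s : ℕ) : ℕ :=
  Nat.find (p := fun k => IsGoodRow n s (Denumerable.ofNat (List ℕ) k)) <| by
    obtain ⟨l, hl⟩ := exists_isGoodRow n s
    exact ⟨Encodable.encode l, by rwa [Denumerable.ofNat_encode]⟩

/-- A good row, chosen computably in `n` and `s`. -/
noncomputable def goodRow (n s : ℕ) : List ℕ :=
  Denumerable.ofNat (List ℕ) (goodRowCode n s)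

theorem isGoodRow_goodRow (n s : ℕ) : IsGoodRow n s (goodRow n s) := by
  classical
  exact Nat.find_spec (p := fun k => IsGoodRow n s (Denumerable.ofNat (List ℕ) k)) _

theorem computable_goodRow : Computable₂ goodRow := by
  classical
  have hdec : Primrec fun q : (ℕ × ℕ) × ℕ =>
      decide (IsGoodRow q.1.1 q.1.2 (Denumerable.ofNat (List ℕ) q.2)) :=
    (primrecPred_isGoodRow (Primrec.fst.comp Primrec.fst) (Primrec.snd.comp Primrec.fst)
      ((Primrec.ofNat (List ℕ)).comp Primrec.snd)).decide
  have hcode : Computable fun q : ℕ × ℕ => goodRowCode q.1 q.2 := by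
    refine (Partrec.rfind (p := fun (q : ℕ × ℕ) k => Part.some
      (decide (IsGoodRow q.1 q.2 (Denumerable.ofNat (List ℕ) k)))) hdec.to_comp).of_eq_tot
      fun q => Nat.mem_rfind.2 ⟨?_, fun {k} hk => ?_⟩
    · exact Part.mem_some_iff.2 (decide_eq_true (isGoodRow_goodRow q.1 q.2)).symm
    · exact Part.mem_some_iff.2 (decide_eq_false (Nat.find_min _ hk)).symm
  exact (Computable.ofNat (List ℕ)).comp hcode

/-- The color of the pair `{a, b}` in the coloring built for the program `e`: the larger element `s`
gives the stage, and its row is a good one for the `m e s` first indices. -/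
noncomputable def diagonalColor (m : ℕ → ℕ → ℕ) (e a b : ℕ) : ℕ :=
  listColor (goodRow (m e (max a b)) (max a b)) (min a b)

theorem diagonalColor_comm (m : ℕ → ℕ → ℕ) (e a b : ℕ) :
    diagonalColor m e a b = diagonalColor m e b a := by
  rw [diagonalColor, diagonalColor, max_comm, min_comm]

theorem diagonalColor_lt_two (m : ℕ → ℕ → ℕ) (e a b : ℕ) : diagonalColor m e a b < 2 := by
  rw [diagonalColor, listColor]
  split_ifs <;> omega

/-- By the recursion theorem some program `e` computes the coloring that is built for `e`. -/
theorem exists_phi_eq_diagonalColor {m : ℕ → ℕ → ℕ} (hm : Primrec₂ m) :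
    ∃ e, ∀ n, phi e n = Part.some (diagonalColor m e n.unpair.1 n.unpair.2) := by
  have hcomp : Computable₂ fun (c : Nat.Partrec.Code) (n : ℕ) =>
      diagonalColor m (Encodable.encode c) n.unpair.1 n.unpair.2 := by
    have hu : Primrec fun q : Nat.Partrec.Code × ℕ => q.2.unpair :=
      Primrec.unpair.comp Primrec.snd
    have hmax := Primrec.nat_max.comp (Primrec.fst.comp hu) (Primrec.snd.comp hu)
    have hmin := Primrec.nat_min.comp (Primrec.fst.comp hu) (Primrec.snd.comp hu)
    exact primrec_listColor.to_comp.comp (computable_goodRow.comp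
      (hm.comp (Primrec.encode.comp Primrec.fst) hmax).to_comp hmax.to_comp) hmin.to_comp
  obtain ⟨c, hc⟩ := Nat.Partrec.Code.fixed_point₂ hcomp.partrec₂
  exact ⟨Encodable.encode c, fun n => by rw [phi, Denumerable.ofNat_encode, hc]; rfl⟩

theorem exists_coloring_of_comm {g : ℕ → ℕ → ℕ} (hcomm : ∀ a b, g a b = g b a)
    (hg : ∀ a b, g a b < 2) :
    ∃ c : Coloring, ∀ a b (h : a ≠ b), (c (mkPair a b h) : ℕ) = g a b := by
  refine ⟨fun p => ⟨g (p.1.min' (Finset.card_pos.1 (by rw [p.2]; norm_num)))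
    (p.1.max' (Finset.card_pos.1 (by rw [p.2]; norm_num))), hg _ _⟩, fun a b h => ?_⟩
  simp only [mkPair, Finset.min'_pair, Finset.max'_pair]
  rcases le_total a b with hab | hab
  · rw [min_eq_left hab, max_eq_right hab]
  · rw [min_eq_right hab, max_eq_left hab, hcomm]

/-- The diagonal coloring defeats all indices below the eventual value of `m e`. If `pi02Set a` is
infinite, then some fixed finite subset of it is split by all late rows, in particular by the row of
a late element of `pi02Set a` itself. -/
theorem exists_isCode_forall_not_isInfiniteHomogeneous {m : ℕ → ℕ → ℕ} (hm : Primrec₂ m) :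
    ∃ e c, IsCode e c ∧ ∀ b, (∀ᶠ s in Filter.atTop, m e s = b) →
      ∀ a < b, ¬ IsInfiniteHomogeneous c (pi02Set a) := by
  obtain ⟨e, he⟩ := exists_phi_eq_diagonalColor hm
  obtain ⟨c, hc⟩ := exists_coloring_of_comm (diagonalColor_comm m e) (diagonalColor_lt_two m e)
  refine ⟨e, c, ⟨fun n => ?_, fun a b h => ?_⟩, ?_⟩
  · rw [he]; trivial
  · rw [he, Nat.unpair_pair, hc]
    exact Part.mem_some _
  rintro b hb a hab ⟨hinf, i, hi⟩
  obtain ⟨T, hT⟩ := eventually_candidates_approx hinf (4 * b + 1)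
  obtain ⟨S, hS⟩ := Filter.eventually_atTop.1 (hT.and hb)
  obtain ⟨s, hs, hsS⟩ := hinf.exists_gt (max S T)
  have hSs := (le_max_left S T).trans_lt hsS
  have hTs := (le_max_right S T).trans_lt hsS
  obtain ⟨⟨hcard, hsub⟩, hms⟩ := hS s hSs.le
  have hrow := isGoodRow_goodRow (m e s) s
  rw [hms] at hrow
  obtain ⟨⟨y, hy, hy0⟩, z, hz, hz1⟩ := hrow T (by omega) a hab hcard
  have hcol : ∀ x ∈ candidates (approx a s) (4 * b + 1) T, listColor (goodRow b s) x = i := by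
    intro x hx
    have hxs : x < s :=
      (Finset.mem_range.1 (candidates_subset_range _ _ _ hx)).trans hTs
    have h := hc x s hxs.ne
    rw [hi _ (by simp [mkPair, Set.insert_subset_iff, hs, hsub hx])] at h
    rw [h, diagonalColor, max_eq_right hxs.le, min_eq_left hxs.le, hms]
  have := hcol y hy
  have := hcol z hz
  omega

/-! ### Bounds on the indices provided by the output of a program -/

theorem primrec_evaln_const (cf : Nat.Partrec.Code) :
    Primrec fun q : ℕ × ℕ => Nat.Partrec.Code.evaln q.2 cf q.1 :=
  Nat.Partrec.Code.primrec_evaln.comp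
    (Primrec.pair (Primrec.pair Primrec.snd (Primrec.const cf)) Primrec.fst)

theorem eventually_evaln_eq_some {cf : Nat.Partrec.Code} {e v : ℕ} (h : v ∈ cf.eval e) :
    ∀ᶠ s in Filter.atTop, Nat.Partrec.Code.evaln s cf e = some v := by
  obtain ⟨k, hk⟩ := Nat.Partrec.Code.evaln_complete.1 h
  filter_upwards [Filter.eventually_ge_atTop k] with s hs
  exact Nat.Partrec.Code.evaln_mono hs hk

/-- A bound for the elements enumerated into `W i` by stage `s`: one more than the largest of them,
and `0` if there are none. The truncated value of `b - 1` at `b = 0` plays no role, since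
`Nat.findGreatest` returns `0` by default. -/
def enumBound (i s : ℕ) : ℕ :=
  Nat.findGreatest (fun b => (Nat.Partrec.Code.evaln s (Denumerable.ofNat _ i) (b - 1)).isSome) s

theorem primrec_enumBound : Primrec₂ enumBound := by
  refine Primrec.nat_findGreatest (p := fun (q : ℕ × ℕ) b =>
    (Nat.Partrec.Code.evaln q.2 (Denumerable.ofNat _ q.1) (b - 1)).isSome) Primrec.snd ?_
  refine Primrec.eq.comp (Primrec.option_isSome.comp (Nat.Partrec.Code.primrec_evaln.comp
    (Primrec.pair (Primrec.pair (Primrec.snd.comp Primrec.fst) ?_) ?_))) (Primrec.const true)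
  · exact (Primrec.ofNat Nat.Partrec.Code).comp (Primrec.fst.comp Primrec.fst)
  · exact Primrec.nat_sub.comp Primrec.snd (Primrec.const 1)

theorem lt_enumBound {i a s : ℕ} {v : ℕ}
    (h : v ∈ Nat.Partrec.Code.evaln s (Denumerable.ofNat _ i) a) : a < enumBound i s :=
  Nat.le_findGreatest (Nat.Partrec.Code.evaln_bound h)
    (Option.isSome_iff_exists.2 ⟨v, by simpa using h⟩)

theorem enumBound_mono (i : ℕ) : Monotone (enumBound i) := by
  refine fun s s' h => Nat.findGreatest_mono (fun b hb => ?_) h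
  obtain ⟨v, hv⟩ := Option.isSome_iff_exists.1 hb
  exact Option.isSome_iff_exists.2 ⟨v, Nat.Partrec.Code.evaln_mono h hv⟩

theorem exists_eventually_enumBound_eq {i : ℕ} (h : (W i).Finite) :
    ∃ b, (∀ᶠ s in Filter.atTop, enumBound i s = b) ∧ ∀ a ∈ W i, a < b := by
  obtain ⟨N, hN⟩ := h.bddAbove
  have hbdd : ∀ s, enumBound i s ≤ N + 1 := by
    intro s
    by_contra! hlt
    have hs := Nat.findGreatest_of_ne_zero (n := s) (P := fun b =>
      (Nat.Partrec.Code.evaln s (Denumerable.ofNat _ i) (b - 1)).isSome) rfl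
      (show enumBound i s ≠ 0 by omega)
    obtain ⟨v, hv⟩ := Option.isSome_iff_exists.1 hs
    have : enumBound i s - 1 ≤ N :=
      hN (Part.dom_iff_mem.2 ⟨v, Nat.Partrec.Code.evaln_sound hv⟩)
    omega
  obtain ⟨b, S, hS⟩ := converges_of_monotone_of_bounded (enumBound_mono i) hbdd
  refine ⟨b, Filter.eventually_atTop.2 ⟨S, hS⟩, fun a ha => ?_⟩
  obtain ⟨v, hv⟩ := Part.dom_iff_mem.1 ha
  obtain ⟨k, hk⟩ := Nat.Partrec.Code.evaln_complete.1 hv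
  rw [← hS (max k S) (le_max_right _ _)]
  exact lt_enumBound (Nat.Partrec.Code.evaln_mono (le_max_left k S) hk)

theorem lt_of_mem_canonicalFinset {a u : ℕ} (h : a ∈ canonicalFinset u) : a < u := by
  have : a ∈ u.bitIndices := by simpa [canonicalFinset, Finset.equivBitIndices] using h
  exact Nat.lt_two_pow_self.trans_le (Nat.two_pow_le_of_mem_bitIndices this)

/-- The diagonal coloring against a partial computable `f`, where `g v s` is an approximation at
stage `s` to a strict upper bound on the indices that the output `v` of `f` provides. Until `f e` is
seen to halt the bound is taken to be `0`. -/
theorem exists_isCode_forall_not_isInfiniteHomogeneous_of_partrec {f : ℕ →. ℕ} (hf : Partrec f)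
    {g : ℕ → ℕ → ℕ} (hg : Primrec₂ g) :
    ∃ e c, IsCode e c ∧ ∀ v ∈ f e, ∀ b, (∀ᶠ s in Filter.atTop, g v s = b) →
      ∀ a < b, ¬ IsInfiniteHomogeneous c (pi02Set a) := by
  obtain ⟨cf, rfl⟩ := Nat.Partrec.Code.exists_code.1 (Partrec.nat_iff.1 hf)
  have hm : Primrec₂ fun e s =>
      ((Nat.Partrec.Code.evaln s cf e).map fun v => g v s).getD 0 :=
    Primrec.option_getD.comp (Primrec.option_map (primrec_evaln_const cf)
      (hg.comp Primrec.snd (Primrec.snd.comp Primrec.fst))) (Primrec.const 0)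
  obtain ⟨e, c, hec, h⟩ := exists_isCode_forall_not_isInfiniteHomogeneous hm
  refine ⟨e, c, hec, fun v hv b hb => h b ?_⟩
  filter_upwards [eventually_evaln_eq_some hv, hb] with s hs hsb
  simp [hs, hsb]

end RamseyPairs

theorem mainTheorem1 :
    (¬ ∃ f : ℕ →. ℕ, Partrec f ∧
      ∀ (e : ℕ) (c : Coloring), IsCode e c →
        ∃ i ∈ f e, (W i).Finite ∧ ∃ a ∈ W i, IsInfiniteHomogeneous c (pi02Set a)) ∧
    (¬ ∃ f : ℕ →. ℕ, Partrec f ∧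
      ∀ (e : ℕ) (c : Coloring), IsCode e c →
        ∃ u ∈ f e, ∃ a ∈ canonicalFinset u, IsInfiniteHomogeneous c (pi02Set a)) := by
  constructor
  · rintro ⟨f, hf, h⟩
    obtain ⟨e, c, hec, hdiag⟩ :=
      exists_isCode_forall_not_isInfiniteHomogeneous_of_partrec hf primrec_enumBound
    obtain ⟨i, hi, hfin, a, ha, hhom⟩ := h e c hec
    obtain ⟨b, hb, hlt⟩ := exists_eventually_enumBound_eq hfin
    exact hdiag i hi b hb a (hlt a ha) hhom
  · rintro ⟨f, hf, h⟩
    obtain ⟨e, c, hec, hdiag⟩ :=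
      exists_isCode_forall_not_isInfiniteHomogeneous_of_partrec hf (g := fun u _ => u) Primrec.fst
    obtain ⟨u, hu, a, ha, hhom⟩ := h e c hec
    exact hdiag u hu u (.of_forall fun _ => rfl) a (lt_of_mem_canonicalFinset ha) hhom
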